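/- For groups $A$ and $B$, let $$A\square B=\langle A,B,t \mid [a,b]=[a,tbt^{-1}]=1,\ a\in A,\ b\in B\rangle ,$$ i.e. the quotient of the free product $A*B*\langle t\rangle$ by the normal closure of all $[a,b]$ and $[a,tbt^{-1}]$ with $a\in A$, $b\in B$. Let $P(A,B)$ be the graph product over the path $$\mathbb{Z}_2 \;\text{---}\; A \;\text{---}\; B \;\text{---}\; \mathbb{Z}_2 ,$$ i.e. the quotient of the free product of these four groups by the normal closure of the commutators $[g,h]$ with $g,h$ in adjacent vertex groups. Let $x$ be the generator of the $\mathbb{Z}_2$ adjacent to $A$ and $y$ the generator of the $\mathbb{Z}_2$ adjacent to $B$. (1) For all groups $A$ and $B$ there is an injective homomorphism $A\square B\to P(A,B)$ that sends every $a\in A$ to $a\in A\subset P(A,B)$, every $b\in B$ to $b\in B\subset P(A,B)$, and $t$ to $xy$. (2) For a group $A$, let $A^\rtimes$ be the fundamental group of the graph of groups with a single vertex labelled by $A\times A$ and a single loop labelled by $A$, the edge group being sent to $A\times A$ first as the left factor and next as the right factor; in other words, $A^\rtimes$ is the HNN extension of $A\times A$ with stable letter $t$ and $t(a,1)t^{-1}=(1,a)$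 for all $a\in A$. Then there is an injective homomorphism $\iota: A\square A\to A^\rtimes$ whose image has index two and which sends an element $a$ of the first copy of $A$ to $(a,1)$, an element $a$ of the second copy to $(1,a)=t(a,1)t^{-1}$, and $t$ to $t^{-2}$. Moreover there is an injective homomorphism $A\square A\to P(A,A)$ that sends the two copies of $A$ identically to the two vertex groups $A$ (the first to the first, the second to the second) and $t$ to $xy$, and whose image $H$ is a virtual retract of $P(A,A)$: there are a finite-index subgroup $K\le P(A,A)$ containing $H$ and a homomorphism $r:K\to H$ with $r|_H=\mathrm{Id}_H$. -/

import Mathlib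

universe u v w

open scoped commutatorElement

/-! ### Graph products of groups -/

/-- The relators of the graph product: the commutators `[g, h]` with `g ∈ G i`, `h ∈ G j`, where
`i` and `j` are adjacent vertices. -/
def graphProductRels {V : Type u} (Γ : SimpleGraph V) (G : V → Type w) [∀ i, Group (G i)] :
    Set (Monoid.CoprodI G) :=
  {r | ∃ (i j : V) (g : G i) (h : G j), Γ.Adj i j ∧
    r = ⁅Monoid.CoprodI.of g, Monoid.CoprodI.of h⁆}

/-- The graph product `ΓG`: the quotient of the free product of the vertex groups by the normal
closure of the commutators of elements of adjacent vertex groups. -/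
abbrev GraphProduct {V : Type u} (Γ : SimpleGraph V) (G : V → Type w) [∀ i, Group (G i)] :
    Type (max u w) :=
  Monoid.CoprodI G ⧸ Subgroup.normalClosure (graphProductRels Γ G)

/-- The canonical map from a vertex group to the graph product. -/
def GraphProduct.of {V : Type u} (Γ : SimpleGraph V) (G : V → Type w) [∀ i, Group (G i)]
    (i : V) : G i →* GraphProduct Γ G :=
  (QuotientGroup.mk' (Subgroup.normalClosure (graphProductRels Γ G))).comp Monoid.CoprodI.of

/-! ### The graph product over the path `ℤ₂ — A — B — ℤ₂` -/

/-- The vertex groups `ℤ₂, A, B, ℤ₂` (lifted to a common universe). -/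
abbrev PathFamily (A : Type u) (B : Type v) : Fin 4 → Type (max u v)
  | 0 => ULift.{max u v} (Multiplicative (ZMod 2))
  | 1 => ULift.{v} A
  | 2 => ULift.{u} B
  | 3 => ULift.{max u v} (Multiplicative (ZMod 2))

instance PathFamily.instGroup (A : Type u) (B : Type v) [Group A] [Group B] :
    ∀ i, Group (PathFamily A B i)
  | 0 => inferInstanceAs (Group (ULift.{max u v} (Multiplicative (ZMod 2))))
  | 1 => inferInstanceAs (Group (ULift.{v} A))
  | 2 => inferInstanceAs (Group (ULift.{u} B))
  | 3 => inferInstanceAs (Group (ULift.{max u v} (Multiplicative (ZMod 2))))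

/-- The graph product over the path `0 — 1 — 2 — 3` with vertex groups `ℤ₂, A, B, ℤ₂`. -/
abbrev PathProduct (A : Type u) (B : Type v) [Group A] [Group B] : Type (max u v) :=
  GraphProduct (SimpleGraph.pathGraph 4) (PathFamily A B)

namespace PathProduct

variable (A : Type u) (B : Type v) [Group A] [Group B]

/-- The canonical map from `A` to the graph product `ℤ₂ — A — B — ℤ₂`. -/
def ofLeft : A →* PathProduct A B :=
  (GraphProduct.of (SimpleGraph.pathGraph 4) (PathFamily A B) 1).comp
    (MulEquiv.ulift.{u, v} (α := A)).symm.toMonoidHom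

/-- The canonical map from `B` to the graph product `ℤ₂ — A — B — ℤ₂`. -/
def ofRight : B →* PathProduct A B :=
  (GraphProduct.of (SimpleGraph.pathGraph 4) (PathFamily A B) 2).comp
    (MulEquiv.ulift.{v, u} (α := B)).symm.toMonoidHom

/-- The generator of the `ℤ₂` adjacent to `A`. -/
def x : PathProduct A B :=
  GraphProduct.of (SimpleGraph.pathGraph 4) (PathFamily A B) 0
    (ULift.up (Multiplicative.ofAdd (1 : ZMod 2)))

/-- The generator of the `ℤ₂` adjacent to `B`. -/
def y : PathProduct A B :=
  GraphProduct.of (SimpleGraph.pathGraph 4) (PathFamily A B) 3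
    (ULift.up (Multiplicative.ofAdd (1 : ZMod 2)))

end PathProduct

/-! ### The group `A □ B = ⟨A, B, t | [a, b] = [a, t b t⁻¹] = 1⟩` -/

namespace SquareGroup

variable (A : Type u) (B : Type v) [Group A] [Group B]

/-- The free product `A ∗ B ∗ ⟨t⟩`. -/
abbrev Free : Type (max u v) :=
  Monoid.Coprod (Monoid.Coprod A B) (Multiplicative ℤ)

/-- The copy of `A` in `A ∗ B ∗ ⟨t⟩`. -/
def freeLeft : A →* Free A B := Monoid.Coprod.inl.comp Monoid.Coprod.inl

/-- The copy of `B` in `A ∗ B ∗ ⟨t⟩`. -/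
def freeRight : B →* Free A B := Monoid.Coprod.inl.comp Monoid.Coprod.inr

/-- The free generator `t` of `A ∗ B ∗ ⟨t⟩`. -/
def freeT : Free A B := Monoid.Coprod.inr (Multiplicative.ofAdd (1 : ℤ))

/-- The relators `[a, b]` and `[a, t b t⁻¹]`, for `a ∈ A` and `b ∈ B`. -/
def rels : Set (Free A B) :=
  {r | ∃ (a : A) (b : B), r = ⁅freeLeft A B a, freeRight A B b⁆ ∨
    r = ⁅freeLeft A B a, freeT A B * freeRight A B b * (freeT A B)⁻¹⁆}

end SquareGroup

/-- The group `A □ B = ⟨A, B, t | [a, b] = [a, t b t⁻¹] = 1, a ∈ A, b ∈ B⟩`. -/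
abbrev SquareGroup (A : Type u) (B : Type v) [Group A] [Group B] : Type (max u v) :=
  SquareGroup.Free A B ⧸ Subgroup.normalClosure (SquareGroup.rels A B)

namespace SquareGroup

variable (A : Type u) (B : Type v) [Group A] [Group B]

/-- The canonical map `A → A □ B`. -/
def ofLeft : A →* SquareGroup A B :=
  (QuotientGroup.mk' (Subgroup.normalClosure (rels A B))).comp (freeLeft A B)

/-- The canonical map `B → A □ B`. -/
def ofRight : B →* SquareGroup A B :=
  (QuotientGroup.mk' (Subgroup.normalClosure (rels A B))).comp (freeRight A B)

/-- The generator `t` of `A □ B`. -/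
def t : SquareGroup A B :=
  QuotientGroup.mk' (Subgroup.normalClosure (rels A B)) (freeT A B)

end SquareGroup

/-! ### The group `A^⋊` -/

/-- The isomorphism `(a, 1) ↦ (1, a)` from the left factor to the right factor of `A × A`. -/
noncomputable def leftFactorEquivRightFactor (A : Type u) [Group A] :
    (MonoidHom.inl A A).range ≃* (MonoidHom.inr A A).range :=
  (MonoidHom.ofInjective (f := MonoidHom.inl A A) (fun _ _ h => congrArg Prod.fst h)).symm.trans
    (MonoidHom.ofInjective (f := MonoidHom.inr A A) (fun _ _ h => congrArg Prod.snd h))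

/-- The group `A^⋊`: the fundamental group of the graph of groups with one vertex, labelled by
`A × A`, and one loop, labelled by `A`, whose two monomorphisms are the inclusions of the left and
of the right factor; that is, the HNN extension of `A × A` with `t (a, 1) t⁻¹ = (1, a)`. -/
abbrev RtimesGroup (A : Type u) [Group A] : Type u :=
  HNNExtension (A × A) (MonoidHom.inl A A).range (MonoidHom.inr A A).range
    (leftFactorEquivRightFactor A)

/-- The defining relation of `A^⋊`. -/
theorem RtimesGroup.conj_left (A : Type u) [Group A] (a : A) :
    (HNNExtension.t * HNNExtension.of (a, 1) * HNNExtension.t⁻¹ : RtimesGroup A) =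
      HNNExtension.of (1, a) := by
  have h := HNNExtension.equiv_eq_conj (φ := leftFactorEquivRightFactor A)
    ((MonoidHom.ofInjective (f := MonoidHom.inl A A) (fun _ _ h => congrArg Prod.fst h)) a)
  have e : leftFactorEquivRightFactor A
      ((MonoidHom.ofInjective (f := MonoidHom.inl A A) (fun _ _ h => congrArg Prod.fst h)) a) =
      (MonoidHom.ofInjective (f := MonoidHom.inr A A) (fun _ _ h => congrArg Prod.snd h)) a := by
    simp [leftFactorEquivRightFactor]
  rw [e] at h
  exact h.symm

/-! ### Virtual retracts -/

/-- `H` is a virtual retract of `G`: it is contained in a finite-index subgroup `K` of `G` for which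
there is a homomorphism `K → H` restricting to the identity on `H`. -/
def IsVirtualRetract {G : Type u} [Group G] (H : Subgroup G) : Prop :=
  ∃ K : Subgroup G, K.FiniteIndex ∧ H ≤ K ∧
    ∃ r : K →* H, ∀ (k : K) (hk : (k : G) ∈ H), r k = ⟨k, hk⟩

/-! Both embeddings realize `A □ B` as a subgroup of index two, so the missing order-two symmetry is
an automorphism of `A □ B` itself. In the path product, conjugation by `x` fixes `A`, sends `b` to
`t b t⁻¹` (as `y` commutes with `B`) and inverts `t = x y`; this is the involution `flip`. In `A^⋊`,
conjugation by the stable letter induces `swap`, whose square is conjugation by `t⁻¹`.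

Injectivity needs no normal forms. From such an automorphism, `exists_extension_of_sq_eq_conj`
builds an extension `E` of `A □ B` by `ℤ₂`. The universal property of the large group gives a map
`F` to `E` whose composite with the candidate embedding is the inclusion of `A □ B` in `E`; hence
the candidate is injective. `MonoidHom.index_range_eq_two` then gives index two, with the map to
`ℤ₂` separating the extra generator from the image. A subgroup of finite index is a virtual retract
through its own identity map. -/

/-! ### Extensions by a group of order two -/

/-- An automorphism `α` of `N` which fixes `c` and whose square is conjugation by `c` is realized by
conjugation by an element `s` with `s ^ 2 = c` in an extension of `N` by `ℤ₂`. -/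
theorem exists_extension_of_sq_eq_conj {N : Type u} [Group N] (α : MulAut N) (c : N)
    (hα : ∀ n, α (α n) = c * n * c⁻¹) (hc : α c = c) :
    ∃ (E : Type u) (_ : Group E) (i : N →* E) (s : E) (ε : E →* Multiplicative (ZMod 2)),
      Function.Injective i ∧ s * s = i c ∧ (∀ n, s * i n = i (α n) * s) ∧
      (∀ n, ε (i n) = 1) ∧ ε s ≠ 1 := by
  let φ : Multiplicative ℤ →* MulAut N := zpowersHom (MulAut N) α
  let s : N ⋊[φ] Multiplicative ℤ := SemidirectProduct.inr (Multiplicative.ofAdd 1)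
  let j : N →* N ⋊[φ] Multiplicative ℤ := SemidirectProduct.inl
  have hs (n : N) : s * j n = j (α n) * s := by
    have h := SemidirectProduct.inl_aut (φ := φ) (Multiplicative.ofAdd 1) n
    have hφ : φ (Multiplicative.ofAdd 1) = α := by simp [φ]
    rw [hφ] at h
    simp [s, j, h]
  have hgen : Subgroup.closure (Set.range j ∪ {s}) = ⊤ := by
    rw [eq_top_iff]
    rintro x -
    rw [← SemidirectProduct.inl_left_mul_inr_right x]
    refine mul_mem (Subgroup.subset_closure (Or.inl ⟨_, rfl⟩)) ?_
    have : (SemidirectProduct.inr x.right : N ⋊[φ] Multiplicative ℤ) =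
        s ^ (Multiplicative.toAdd x.right : ℤ) := by
      have h := map_zpow (SemidirectProduct.inr : Multiplicative ℤ →* N ⋊[φ] Multiplicative ℤ)
        (Multiplicative.ofAdd 1) (Multiplicative.toAdd x.right)
      rw [← ofAdd_zsmul, smul_eq_mul, mul_one, ofAdd_toAdd] at h
      exact h
    rw [this]
    have hmem : s ∈ Subgroup.closure (Set.range j ∪ {s}) := Subgroup.subset_closure (Or.inr rfl)
    exact zpow_mem hmem _
  -- `E` is the quotient of `N ⋊ ℤ` by `⟨z⟩`, which imposes `s ^ 2 = c`. Here `z` commutes with `N`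
  -- because `α ^ 2` is conjugation by `c`, and with `s` because `α c = c`; so `⟨z⟩` is central,
  -- hence normal.
  let z : N ⋊[φ] Multiplicative ℤ := j c⁻¹ * (s * s)
  have hjz (n : N) : j n * z = z * j n := by
    have h1 : j c⁻¹ * (s * s) * j n = j (c⁻¹ * α (α n)) * (s * s) := by
      rw [mul_assoc, mul_assoc s s, hs, ← mul_assoc s, hs, map_mul]
      simp only [mul_assoc]
    simp only [z]
    rw [h1, hα, ← mul_assoc, ← map_mul]
    simp [mul_assoc]
  have hsz : s * z = z * s := by
    simp only [z]
    rw [← mul_assoc, hs, map_inv, hc]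
    simp only [mul_assoc]
  have hz : z ∈ Subgroup.center (N ⋊[φ] Multiplicative ℤ) := by
    have h : Subgroup.closure (Set.range j ∪ {s}) ≤ Subgroup.centralizer {z} := by
      rw [Subgroup.closure_le]
      rintro _ (⟨n, rfl⟩ | rfl)
      · exact Subgroup.mem_centralizer_singleton_iff.2 (hjz n)
      · exact Subgroup.mem_centralizer_singleton_iff.2 hsz
    rw [hgen] at h
    exact Subgroup.mem_center_iff.2 fun g =>
      Subgroup.mem_centralizer_singleton_iff.1 (h (Subgroup.mem_top g))
  have : (Subgroup.zpowers z).Normal := by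
    refine ⟨fun n hn g => ?_⟩
    have h := (Subgroup.zpowers_le.2 hz) hn
    rw [Subgroup.mem_center_iff.1 h g]
    simpa using hn
  let p : N ⋊[φ] Multiplicative ℤ →* Multiplicative (ZMod 2) :=
    (AddMonoidHom.toMultiplicative (Int.castAddHom (ZMod 2))).comp SemidirectProduct.rightHom
  have hp : ∀ x ∈ Subgroup.zpowers z, p x = 1 := by
    rintro _ ⟨k, rfl⟩
    have : p z = 1 := by
      simp [p, z, s, j]
      decide
    simp [this]
  refine ⟨(N ⋊[φ] Multiplicative ℤ) ⧸ Subgroup.zpowers z, inferInstance,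
    (QuotientGroup.mk' _).comp j, QuotientGroup.mk' _ s, QuotientGroup.lift _ p hp, ?_, ?_, ?_,
    ?_, ?_⟩
  · rw [injective_iff_map_eq_one]
    intro n hn
    have h : j n ∈ Subgroup.zpowers z := (QuotientGroup.eq_one_iff _).1 hn
    obtain ⟨k, hk⟩ := h
    have hr := congrArg (fun x => Multiplicative.toAdd (SemidirectProduct.rightHom x)) hk
    -- The `ℤ`-coordinate of `z ^ k` is `2 * k`, while that of `j n` is `0`, so `⟨z⟩` meets `N`
    -- trivially.
    have hk0 : k = 0 := by
      simp only [map_zpow, z, j, s, map_mul, SemidirectProduct.rightHom_inl,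
        SemidirectProduct.rightHom_inr, toAdd_zpow, toAdd_mul, toAdd_one, toAdd_ofAdd,
        smul_eq_mul] at hr
      omega
    subst hk0
    have : j n = j 1 := by simpa using hk.symm
    exact SemidirectProduct.inl_injective this
  · rw [← map_mul, MonoidHom.comp_apply, QuotientGroup.mk'_eq_mk']
    exact ⟨z⁻¹, inv_mem (Subgroup.mem_zpowers z), by
      rw [mul_inv_eq_iff_eq_mul]
      simp [z]⟩
  · intro n
    simp only [MonoidHom.comp_apply, ← map_mul, hs]
  · intro n
    change p (j n) = 1
    simp [p, j]
  · change p s ≠ 1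
    simp only [p, s, MonoidHom.comp_apply, SemidirectProduct.rightHom_inr]
    decide

/-- If `G` is generated by the image of `f : N →* G` together with an element `g` that normalizes
this image, whose square lies in it, and which is separated from it by a homomorphism, then the
image has index two. -/
theorem MonoidHom.index_range_eq_two {N G C : Type*} [Group N] [Group G] [Group C] (f : N →* G)
    (g : G) (α : MulAut N) (c : N) (hg : g * g = f c) (hα : ∀ n, g * f n = f (α n) * g)
    (hgen : Subgroup.closure (Set.range f ∪ {g}) = ⊤) (ε : G →* C) (hε : ∀ n, ε (f n) = 1)
    (hεg : ε g ≠ 1) : f.range.index = 2 := by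
  rw [Subgroup.index_eq_two_iff_exists_notMem_and]
  refine ⟨g, ?_, fun b => ?_⟩
  · rintro ⟨n, rfl⟩
    exact hεg (hε n)
  -- It is enough that `f(N) ∪ f(N) g` exhausts `G`; this set contains the generators and is closed
  -- under products and inverses.
  · suffices h : (∃ n, b = f n * g) ∨ ∃ n, b = f n by
      obtain ⟨n, rfl⟩ | ⟨n, rfl⟩ := h
      · exact Or.inl ⟨n * c, by rw [mul_assoc, hg, map_mul]⟩
      · exact Or.inr ⟨n, rfl⟩
    have hb : b ∈ Subgroup.closure (Set.range f ∪ {g}) := hgen ▸ Subgroup.mem_top b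
    have hginv : g⁻¹ = f c⁻¹ * g := by
      rw [map_inv, ← hg]
      group
    induction hb using Subgroup.closure_induction with
    | mem x hx =>
      rcases hx with ⟨n, rfl⟩ | rfl
      · exact Or.inr ⟨n, rfl⟩
      · exact Or.inl ⟨1, by simp⟩
    | one => exact Or.inr ⟨1, by simp⟩
    | mul x y _ _ hx hy =>
      obtain ⟨n, rfl⟩ | ⟨n, rfl⟩ := hx <;> obtain ⟨m, rfl⟩ | ⟨m, rfl⟩ := hy
      · refine Or.inr ⟨n * α m * c, ?_⟩
        rw [map_mul, map_mul, ← hg, mul_assoc, ← mul_assoc g, hα]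
        simp only [mul_assoc]
      · refine Or.inl ⟨n * α m, ?_⟩
        rw [map_mul, mul_assoc, hα, mul_assoc]
      · exact Or.inl ⟨n * m, by rw [map_mul, mul_assoc]⟩
      · exact Or.inr ⟨n * m, by rw [map_mul]⟩
    | inv x _ hx =>
      obtain ⟨n, rfl⟩ | ⟨n, rfl⟩ := hx
      · refine Or.inl ⟨c⁻¹ * α n⁻¹, ?_⟩
        rw [mul_inv_rev, hginv, ← map_inv, mul_assoc, hα, map_mul, mul_assoc]
      · exact Or.inr ⟨n⁻¹, by rw [map_inv]⟩

/-- A subgroup of finite index is a virtual retract. -/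
theorem IsVirtualRetract.of_finiteIndex {G : Type u} [Group G] (H : Subgroup G)
    (h : H.FiniteIndex) : IsVirtualRetract H :=
  ⟨H, h, le_rfl, MonoidHom.id H, fun _ _ => rfl⟩

/-! ### The universal property and automorphisms of `A □ B` -/

namespace SquareGroup

variable {A : Type u} {B : Type v} [Group A] [Group B]

theorem commute_left_right (a : A) (b : B) : Commute (ofLeft A B a) (ofRight A B b) := by
  rw [← commutatorElement_eq_one_iff_commute]
  exact (QuotientGroup.eq_one_iff _).2 (Subgroup.subset_normalClosure ⟨a, b, Or.inl rfl⟩)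

theorem commute_left_conj_right (a : A) (b : B) :
    Commute (ofLeft A B a) (t A B * ofRight A B b * (t A B)⁻¹) := by
  rw [← commutatorElement_eq_one_iff_commute]
  exact (QuotientGroup.eq_one_iff _).2 (Subgroup.subset_normalClosure ⟨a, b, Or.inr rfl⟩)

/-- The homomorphism out of `A □ B` with prescribed values on `A`, `B` and `t`. -/
def lift {H : Type*} [Group H] (f : A →* H) (g : B →* H) (s : H)
    (h₁ : ∀ a b, Commute (f a) (g b)) (h₂ : ∀ a b, Commute (f a) (s * g b * s⁻¹)) :
    SquareGroup A B →* H :=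
  QuotientGroup.lift _ (Monoid.Coprod.lift (Monoid.Coprod.lift f g) (zpowersHom H s)) <| by
    refine Subgroup.normalClosure_le_normal (N := MonoidHom.ker _) ?_
    rintro _ ⟨a, b, rfl | rfl⟩
    · simpa [MonoidHom.mem_ker, map_commutatorElement, freeLeft, freeRight,
        commutatorElement_eq_one_iff_commute] using h₁ a b
    · simpa [MonoidHom.mem_ker, map_commutatorElement, freeLeft, freeRight, freeT,
        commutatorElement_eq_one_iff_commute] using h₂ a b

section lift

variable {H : Type*} [Group H] (f : A →* H) (g : B →* H) (s : H)
    (h₁ : ∀ a b, Commute (f a) (g b)) (h₂ : ∀ a b, Commute (f a) (s * g b * s⁻¹))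

@[simp]
theorem lift_ofLeft (a : A) : lift f g s h₁ h₂ (ofLeft A B a) = f a := by
  change Monoid.Coprod.lift (Monoid.Coprod.lift f g) (zpowersHom H s) (freeLeft A B a) = _
  simp [freeLeft]

@[simp]
theorem lift_ofRight (b : B) : lift f g s h₁ h₂ (ofRight A B b) = g b := by
  change Monoid.Coprod.lift (Monoid.Coprod.lift f g) (zpowersHom H s) (freeRight A B b) = _
  simp [freeRight]

@[simp]
theorem lift_t : lift f g s h₁ h₂ (t A B) = s := by
  change Monoid.Coprod.lift (Monoid.Coprod.lift f g) (zpowersHom H s) (freeT A B) = _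
  simp [freeT]

end lift

/-- Homomorphisms out of `A □ B` are determined by their values on `A`, `B` and `t`. -/
theorem hom_ext {H : Type*} [Group H] {f g : SquareGroup A B →* H}
    (h₁ : ∀ a, f (ofLeft A B a) = g (ofLeft A B a))
    (h₂ : ∀ b, f (ofRight A B b) = g (ofRight A B b)) (h₃ : f (t A B) = g (t A B)) : f = g := by
  refine QuotientGroup.monoidHom_ext _ (Monoid.Coprod.hom_ext (Monoid.Coprod.hom_ext ?_ ?_) ?_)
  · exact MonoidHom.ext h₁
  · exact MonoidHom.ext h₂
  · exact MonoidHom.ext_mint h₃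

variable (A B) in
/-- The endomorphism of `A □ B` with `a ↦ a`, `b ↦ t b t⁻¹` and `t ↦ t⁻¹`. -/
def flipHom : SquareGroup A B →* SquareGroup A B :=
  lift (ofLeft A B) ((MulAut.conj (t A B)).toMonoidHom.comp (ofRight A B)) (t A B)⁻¹
    -- The substitution exchanges the two families of relators, since `t⁻¹ (t b t⁻¹) t = b`.
    (fun a b => by simpa using commute_left_conj_right a b)
    (fun a b => by simpa [mul_assoc] using commute_left_right a b)

variable (A B) in
/-- The involution of `A □ B` with `a ↦ a`, `b ↦ t b t⁻¹` and `t ↦ t⁻¹`. -/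
def flip : MulAut (SquareGroup A B) :=
  have h : (flipHom A B).comp (flipHom A B) = MonoidHom.id _ :=
    hom_ext (by simp [flipHom]) (by simp [flipHom, mul_assoc]) (by simp [flipHom])
  MonoidHom.toMulEquiv (flipHom A B) (flipHom A B) h h

theorem flip_apply (g : SquareGroup A B) : flip A B g = flipHom A B g :=
  rfl

@[simp]
theorem flip_ofLeft (a : A) : flip A B (ofLeft A B a) = ofLeft A B a := by
  simp [flip_apply, flipHom]

@[simp]
theorem flip_ofRight (b : B) :
    flip A B (ofRight A B b) = t A B * ofRight A B b * (t A B)⁻¹ := by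
  simp [flip_apply, flipHom]

@[simp]
theorem flip_t : flip A B (t A B) = (t A B)⁻¹ := by
  simp [flip_apply, flipHom]

theorem flip_flip (g : SquareGroup A B) : flip A B (flip A B g) = g :=
  (flip A B).symm_apply_apply g

variable (A) in
/-- The endomorphism of `A □ A` with `(a, b) ↦ (t⁻¹ b t, a)` on the two copies of `A` and `t ↦ t`. -/
def swapHom : SquareGroup A A →* SquareGroup A A :=
  lift (ofRight A A) ((MulAut.conj (t A A)⁻¹).toMonoidHom.comp (ofLeft A A)) (t A A)
    (fun a b => by
      -- Conjugating the second family of relators by `t⁻¹` makes the second copy of `A` commute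
      -- with the `t⁻¹`-conjugate of the first.
      have h := (commute_left_conj_right b a).symm.map (MulAut.conj (t A A)⁻¹)
      simpa [mul_assoc] using h)
    (fun a b => by simpa [mul_assoc] using (commute_left_right b a).symm)

variable (A) in
/-- The automorphism of `A □ A` which sends the first copy of `A` identically to the second one, the
second one to its conjugate `a ↦ t⁻¹ a t` in the first one, and fixes `t`. -/
def swap : MulAut (SquareGroup A A) :=
  MonoidHom.toMulEquiv (swapHom A)
    (lift ((MulAut.conj (t A A)).toMonoidHom.comp (ofRight A A)) (ofLeft A A) (t A A)
      (fun a b => by simpa using (commute_left_conj_right b a).symm)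
      (fun a b => by
        have h := (commute_left_right b a).symm.map (MulAut.conj (t A A))
        simpa using h))
    (hom_ext (by simp [swapHom]) (by simp [swapHom, mul_assoc]) (by simp [swapHom]))
    (hom_ext (by simp [swapHom, mul_assoc]) (by simp [swapHom]) (by simp [swapHom]))

theorem swap_apply (g : SquareGroup A A) : swap A g = swapHom A g :=
  rfl

@[simp]
theorem swap_ofLeft (a : A) : swap A (ofLeft A A a) = ofRight A A a := by
  simp [swap_apply, swapHom]

@[simp]
theorem swap_ofRight (a : A) :
    swap A (ofRight A A a) = (t A A)⁻¹ * ofLeft A A a * t A A := by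
  simp [swap_apply, swapHom]

@[simp]
theorem swap_t : swap A (t A A) = t A A := by
  simp [swap_apply, swapHom]

/-- Checked on generators. The right side has the shape `c * g * c⁻¹` with `c = t⁻¹`, as the
extension lemma requires. -/
theorem swap_swap (g : SquareGroup A A) :
    swap A (swap A g) = (t A A)⁻¹ * g * ((t A A)⁻¹)⁻¹ := by
  have h : (swap A).toMonoidHom.comp (swap A).toMonoidHom =
      (MulAut.conj (t A A)⁻¹).toMonoidHom :=
    hom_ext (by simp) (by simp) (by simp)
  exact DFunLike.congr_fun h g

end SquareGroup

/-! ### The universal property of graph products -/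

namespace GraphProduct

variable {V : Type u} {Γ : SimpleGraph V} {G : V → Type w} [∀ i, Group (G i)]

theorem commute_of {i j : V} (h : Γ.Adj i j) (g : G i) (k : G j) :
    Commute (of Γ G i g) (of Γ G j k) := by
  rw [← commutatorElement_eq_one_iff_commute]
  exact (QuotientGroup.eq_one_iff _).2 (Subgroup.subset_normalClosure ⟨i, j, g, k, h, rfl⟩)

/-- The homomorphism out of a graph product with prescribed values on the vertex groups. -/
def lift {H : Type*} [Group H] (f : ∀ i, G i →* H)
    (hf : ∀ i j, Γ.Adj i j → ∀ g k, Commute (f i g) (f j k)) : GraphProduct Γ G →* H :=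
  QuotientGroup.lift _ (Monoid.CoprodI.lift f) <| by
    refine Subgroup.normalClosure_le_normal (N := MonoidHom.ker _) ?_
    rintro _ ⟨i, j, g, k, h, rfl⟩
    simpa [MonoidHom.mem_ker, map_commutatorElement,
      commutatorElement_eq_one_iff_commute] using hf i j h g k

@[simp]
theorem lift_of {H : Type*} [Group H] (f : ∀ i, G i →* H)
    (hf : ∀ i j, Γ.Adj i j → ∀ g k, Commute (f i g) (f j k)) (i : V) (g : G i) :
    lift f hf (of Γ G i g) = f i g :=
  Monoid.CoprodI.lift_of f g

/-- A subgroup that contains all vertex groups is the whole graph product. -/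
theorem eq_top_of_range_of_le {K : Subgroup (GraphProduct Γ G)}
    (h : ∀ i, (of Γ G i).range ≤ K) : K = ⊤ := by
  rw [eq_top_iff]
  rintro x -
  obtain ⟨x, rfl⟩ := QuotientGroup.mk'_surjective _ x
  induction x using Monoid.CoprodI.induction_on with
  | one => exact one_mem K
  | of i m => exact h i ⟨m, rfl⟩
  | mul x y hx hy =>
    rw [map_mul]
    exact mul_mem hx hy

end GraphProduct

/-- The homomorphism from `ℤ₂` that sends the generator to an element of square one. -/
def zmodTwoHom {H : Type*} [Group H] (s : H) (hs : s * s = 1) :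
    Multiplicative (ZMod 2) →* H :=
  AddMonoidHom.toMultiplicativeLeft
    (ZMod.lift 2 ⟨(zmultiplesHom (Additive H)) (Additive.ofMul s), by
      simpa [two_zsmul] using congrArg Additive.ofMul hs⟩)

@[simp]
theorem zmodTwoHom_ofAdd_one {H : Type*} [Group H] (s : H) (hs : s * s = 1) :
    zmodTwoHom s hs (Multiplicative.ofAdd 1) = s := by
  have h := ZMod.lift_coe 2 (⟨(zmultiplesHom (Additive H)) (Additive.ofMul s), by
      simpa [two_zsmul] using congrArg Additive.ofMul hs⟩ :
      {f : ℤ →+ Additive H // f (2 : ℕ) = 0}) 1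
  simpa [zmodTwoHom] using congrArg Additive.toMul h

theorem eq_one_or_eq_ofAdd_one (z : Multiplicative (ZMod 2)) :
    z = 1 ∨ z = Multiplicative.ofAdd 1 := by
  revert z
  decide

/-! ### The graph product `ℤ₂ — A — B — ℤ₂` -/

namespace PathProduct

variable {A : Type u} {B : Type v} [Group A] [Group B]

theorem x_mul_x : x A B * x A B = 1 := by
  rw [x, ← map_mul, ← map_one (GraphProduct.of (SimpleGraph.pathGraph 4) (PathFamily A B) 0)]
  rfl

theorem y_mul_y : y A B * y A B = 1 := by
  rw [y, ← map_mul, ← map_one (GraphProduct.of (SimpleGraph.pathGraph 4) (PathFamily A B) 3)]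
  rfl

theorem commute_x_left (a : A) : Commute (x A B) (ofLeft A B a) :=
  GraphProduct.commute_of (by simp [SimpleGraph.pathGraph_adj]) _ _

theorem commute_left_right (a : A) (b : B) : Commute (ofLeft A B a) (ofRight A B b) :=
  GraphProduct.commute_of (by simp [SimpleGraph.pathGraph_adj]) _ _

theorem commute_right_y (b : B) : Commute (ofRight A B b) (y A B) :=
  GraphProduct.commute_of (by simp [SimpleGraph.pathGraph_adj]) _ _

/-- The homomorphisms from the vertex groups of `ℤ₂ — A — B — ℤ₂` with prescribed values on the
generators of the two copies of `ℤ₂` and on `A` and `B`. -/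
def vertexHom {H : Type*} [Group H] (f : A →* H) (g : B →* H) (s r : H) (hs : s * s = 1)
    (hr : r * r = 1) : ∀ i, PathFamily A B i →* H
  | 0 => (zmodTwoHom s hs).comp MulEquiv.ulift.toMonoidHom
  | 1 => f.comp (MulEquiv.ulift.{u, v} (α := A)).toMonoidHom
  | 2 => g.comp (MulEquiv.ulift.{v, u} (α := B)).toMonoidHom
  | 3 => (zmodTwoHom r hr).comp MulEquiv.ulift.toMonoidHom

theorem commute_zmodTwoHom {H : Type*} [Group H] {s h : H} (hs : s * s = 1) (hc : Commute s h)
    (z : Multiplicative (ZMod 2)) : Commute (zmodTwoHom s hs z) h := by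
  rcases eq_one_or_eq_ofAdd_one z with rfl | rfl
  · simp
  · simpa using hc

section lift

variable {H : Type*} [Group H] (f : A →* H) (g : B →* H) (s r : H) (hs : s * s = 1)
  (hr : r * r = 1) (h₁ : ∀ a, Commute s (f a)) (h₂ : ∀ a b, Commute (f a) (g b))
  (h₃ : ∀ b, Commute r (g b))

/-- The homomorphism out of the graph product `ℤ₂ — A — B — ℤ₂` with prescribed values on the
generators of the two copies of `ℤ₂` and on `A` and `B`. -/
def lift : PathProduct A B →* H :=
  GraphProduct.lift (vertexHom f g s r hs hr) <| by
    -- By symmetry of commutation only the three edges oriented upwards need checking.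
    have key : ∀ i j : Fin 4, i.val + 1 = j.val → ∀ k l,
        Commute (vertexHom f g s r hs hr i k) (vertexHom f g s r hs hr j l) := by
      intro i j hij k l
      fin_cases i <;> fin_cases j <;> simp at hij
      · exact commute_zmodTwoHom hs (h₁ _) _
      · exact h₂ _ _
      · exact (commute_zmodTwoHom hr (h₃ _) _).symm
    intro i j hij k l
    rcases SimpleGraph.pathGraph_adj.1 hij with h | h
    · exact key i j h k l
    · exact (key j i h l k).symm

@[simp]
theorem lift_ofLeft (a : A) : lift f g s r hs hr h₁ h₂ h₃ (ofLeft A B a) = f a :=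
  GraphProduct.lift_of _ _ 1 _

@[simp]
theorem lift_ofRight (b : B) : lift f g s r hs hr h₁ h₂ h₃ (ofRight A B b) = g b :=
  GraphProduct.lift_of _ _ 2 _

@[simp]
theorem lift_x : lift f g s r hs hr h₁ h₂ h₃ (x A B) = s :=
  (GraphProduct.lift_of _ _ 0 _).trans (zmodTwoHom_ofAdd_one s hs)

@[simp]
theorem lift_y : lift f g s r hs hr h₁ h₂ h₃ (y A B) = r :=
  (GraphProduct.lift_of _ _ 3 _).trans (zmodTwoHom_ofAdd_one r hr)

end lift

/-- A subgroup that contains `x`, `y`, `A` and `B` is everything. -/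
theorem eq_top_of_mem {K : Subgroup (PathProduct A B)} (hx : x A B ∈ K) (hy : y A B ∈ K)
    (hA : ∀ a, ofLeft A B a ∈ K) (hB : ∀ b, ofRight A B b ∈ K) : K = ⊤ := by
  refine GraphProduct.eq_top_of_range_of_le fun i => ?_
  fin_cases i <;> rintro _ ⟨⟨m⟩, rfl⟩
  · rcases eq_one_or_eq_ofAdd_one m with rfl | rfl
    · convert one_mem K
      exact map_one _
    · exact hx
  · exact hA m
  · exact hB m
  · rcases eq_one_or_eq_ofAdd_one m with rfl | rfl
    · convert one_mem K
      exact map_one _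
    · exact hy

end PathProduct

/-! ### Embeddings of `A □ B` -/

namespace SquareGroup

variable (A : Type u) (B : Type v) [Group A] [Group B]

/-- The homomorphism from `A □ B` to the graph product `ℤ₂ — A — B — ℤ₂` with `t ↦ x y`. -/
def toPathProduct : SquareGroup A B →* PathProduct A B :=
  lift (PathProduct.ofLeft A B) (PathProduct.ofRight A B) (PathProduct.x A B * PathProduct.y A B)
    PathProduct.commute_left_right fun a b => by
      -- As `y` commutes with `B` and `x` with `A`, the pair `a`, `t b t⁻¹` is the `x`-conjugate of
      -- the commuting pair `a`, `b`.
      have h : PathProduct.x A B * PathProduct.y A B * PathProduct.ofRight A B b *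
          (PathProduct.x A B * PathProduct.y A B)⁻¹ =
          MulAut.conj (PathProduct.x A B) (PathProduct.ofRight A B b) := by
        rw [mul_assoc (PathProduct.x A B), ← (PathProduct.commute_right_y b).eq, MulAut.conj_apply]
        group
      have h' : PathProduct.ofLeft A B a =
          MulAut.conj (PathProduct.x A B) (PathProduct.ofLeft A B a) := by
        rw [MulAut.conj_apply, (PathProduct.commute_x_left a).eq, mul_inv_cancel_right]
      rw [h, h']
      exact (PathProduct.commute_left_right a b).map _

/-- Both sides come from homomorphisms, so generators suffice; on `t` the point is `x (x y) x⁻¹ = y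
x = (x y)⁻¹`. -/
theorem x_mul_toPathProduct (g : SquareGroup A B) :
    PathProduct.x A B * toPathProduct A B g =
      toPathProduct A B (flip A B g) * PathProduct.x A B := by
  have hx : (PathProduct.x A B)⁻¹ = PathProduct.x A B :=
    inv_eq_of_mul_eq_one_left PathProduct.x_mul_x
  have hy : (PathProduct.y A B)⁻¹ = PathProduct.y A B :=
    inv_eq_of_mul_eq_one_left PathProduct.y_mul_y
  have h : (MulAut.conj (PathProduct.x A B)).toMonoidHom.comp (toPathProduct A B) =
      (toPathProduct A B).comp (flip A B).toMonoidHom := by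
    refine hom_ext (fun a => ?_) (fun b => ?_) ?_
    · simp [toPathProduct, (PathProduct.commute_x_left a).eq]
    · simp only [toPathProduct, MonoidHom.comp_apply, MulEquiv.coe_toMonoidHom, flip_ofRight,
        map_mul, map_inv, lift_ofRight, lift_t, MulAut.conj_apply]
      rw [mul_assoc (PathProduct.x A B) (PathProduct.y A B),
        ← (PathProduct.commute_right_y b).eq]
      group
    · simp only [toPathProduct, MonoidHom.comp_apply, MulEquiv.coe_toMonoidHom, flip_t,
        map_inv, lift_t, MulAut.conj_apply, mul_inv_rev, hx, hy]
      rw [← mul_assoc, PathProduct.x_mul_x, one_mul]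
  rw [← mul_inv_eq_iff_eq_mul]
  exact DFunLike.congr_fun h g

theorem toPathProduct_injective_and_index :
    Function.Injective (toPathProduct A B) ∧ (toPathProduct A B).range.index = 2 := by
  obtain ⟨E, _, i, s, ε, hi, hss, hs, hεi, hεs⟩ :=
    exists_extension_of_sq_eq_conj (flip A B) 1 (fun n => by simp [flip_flip]) (map_one _)
  rw [map_one] at hss
  let F : PathProduct A B →* E :=
    -- With `x ↦ s`, the requirement `x y ↦ i t` forces `y ↦ s⁻¹ * i t = s * i t`. This is an
    -- involution because `flip` inverts `t`.
    PathProduct.lift (i.comp (ofLeft A B)) (i.comp (ofRight A B)) s (s * i (t A B)) hss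
      (by
        nth_rewrite 1 [hs]
        rw [mul_assoc, ← mul_assoc s, hss, one_mul, ← map_mul, flip_t, inv_mul_cancel, map_one])
      (fun a => by
        have h := hs (ofLeft A B a)
        rw [flip_ofLeft] at h
        exact h)
      (fun a b => (commute_left_right a b).map i)
      (fun b => by
        change s * i (t A B) * i (ofRight A B b) = i (ofRight A B b) * (s * i (t A B))
        -- Moving `s` to the right on both sides leaves `flip (t b) = b t⁻¹` against `b * flip t`.
        rw [mul_assoc, ← map_mul, hs, hs, ← mul_assoc, ← map_mul]
        simp [mul_assoc])
  have hFx : F (PathProduct.x A B) = s := PathProduct.lift_x _ _ _ _ _ _ _ _ _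
  have hFy : F (PathProduct.y A B) = s * i (t A B) := PathProduct.lift_y _ _ _ _ _ _ _ _ _
  have hFA (a : A) : F (PathProduct.ofLeft A B a) = i (ofLeft A B a) :=
    PathProduct.lift_ofLeft _ _ _ _ _ _ _ _ _ _
  have hFB (b : B) : F (PathProduct.ofRight A B b) = i (ofRight A B b) :=
    PathProduct.lift_ofRight _ _ _ _ _ _ _ _ _ _
  have hF : F.comp (toPathProduct A B) = i := by
    refine hom_ext (by simp [hFA, toPathProduct]) (by simp [hFB, toPathProduct]) ?_
    simp [hFx, hFy, toPathProduct, ← mul_assoc, hss]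
  have hF' (g : SquareGroup A B) : F (toPathProduct A B g) = i g := DFunLike.congr_fun hF g
  refine ⟨Function.Injective.of_comp (f := F) ?_, ?_⟩
  · rwa [← MonoidHom.coe_comp, hF]
  · refine MonoidHom.index_range_eq_two _ (PathProduct.x A B) (flip A B) 1
      (by rw [PathProduct.x_mul_x, map_one]) (x_mul_toPathProduct A B) ?_ (ε.comp F)
      (fun n => by simp [hF', hεi]) (by simpa [hFx] using hεs)
    have hx : PathProduct.x A B ∈
        Subgroup.closure (Set.range (toPathProduct A B) ∪ {PathProduct.x A B}) :=
      Subgroup.subset_closure (Or.inr rfl)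
    have hr (g : SquareGroup A B) : toPathProduct A B g ∈
        Subgroup.closure (Set.range (toPathProduct A B) ∪ {PathProduct.x A B}) :=
      Subgroup.subset_closure (Or.inl ⟨g, rfl⟩)
    refine PathProduct.eq_top_of_mem hx ?_ (fun a => ?_) (fun b => ?_)
    -- Here `y = x⁻¹ (x y)`, and `x y` is the image of `t`.
    · have h := mul_mem (inv_mem hx) (hr (t A B))
      simpa [toPathProduct] using h
    · simpa [toPathProduct] using hr (ofLeft A B a)
    · simpa [toPathProduct] using hr (ofRight A B b)

theorem commute_of_left_right (a b : A) :
    Commute (HNNExtension.of (a, 1) : RtimesGroup A) (HNNExtension.of (1, b)) := by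
  simp [Commute, SemiconjBy, ← map_mul]

theorem conj_t_inv_sq (a : A) :
    (HNNExtension.t⁻¹ ^ 2 * HNNExtension.of (1, a) * (HNNExtension.t⁻¹ ^ 2)⁻¹ : RtimesGroup A) =
      MulAut.conj HNNExtension.t⁻¹ (HNNExtension.of (a, 1)) := by
  rw [← RtimesGroup.conj_left, MulAut.conj_apply]
  group

/-- The homomorphism from `A □ A` to `A^⋊` with `t ↦ t⁻²`. -/
noncomputable def toRtimesGroup : SquareGroup A A →* RtimesGroup A :=
  lift (HNNExtension.of.comp (MonoidHom.inl A A)) (HNNExtension.of.comp (MonoidHom.inr A A))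
    (HNNExtension.t⁻¹ ^ 2) (fun a b => commute_of_left_right A a b) fun a b => by
      -- Both `(a, 1)` and the conjugate of `(1, b)` by the image of `t` are conjugates, by the
      -- inverse stable letter, of elements of opposite factors.
      have h : (HNNExtension.of (a, 1) : RtimesGroup A) =
          MulAut.conj HNNExtension.t⁻¹ (HNNExtension.of (1, a)) := by
        rw [← RtimesGroup.conj_left, MulAut.conj_apply]
        group
      simp only [MonoidHom.comp_apply, MonoidHom.inl_apply, MonoidHom.inr_apply]
      rw [conj_t_inv_sq, h]
      exact (commute_of_left_right A b a).symm.map _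

@[simp]
theorem toRtimesGroup_ofLeft (a : A) : toRtimesGroup A (ofLeft A A a) = HNNExtension.of (a, 1) :=
  lift_ofLeft _ _ _ _ _ _

@[simp]
theorem toRtimesGroup_ofRight (a : A) :
    toRtimesGroup A (ofRight A A a) = HNNExtension.of (1, a) :=
  lift_ofRight _ _ _ _ _ _

@[simp]
theorem toRtimesGroup_t : toRtimesGroup A (t A A) = HNNExtension.t⁻¹ ^ 2 :=
  lift_t _ _ _ _ _

/-- The stable letter normalizes the image and acts on it as `swap`; on the second copy of `A` this
uses that its square is the image of `t⁻¹`. -/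
theorem t_mul_toRtimesGroup (g : SquareGroup A A) :
    HNNExtension.t * toRtimesGroup A g = toRtimesGroup A (swap A g) * HNNExtension.t := by
  have h : (MulAut.conj HNNExtension.t).toMonoidHom.comp (toRtimesGroup A) =
      (toRtimesGroup A).comp (swap A).toMonoidHom := by
    refine hom_ext (fun a => ?_) (fun a => ?_) ?_
    · simp [RtimesGroup.conj_left]
    · simp only [MonoidHom.comp_apply, MulEquiv.coe_toMonoidHom, swap_ofRight, map_mul, map_inv,
        toRtimesGroup_ofRight, toRtimesGroup_ofLeft, toRtimesGroup_t, MulAut.conj_apply]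
      rw [← RtimesGroup.conj_left]
      simp [pow_two, mul_assoc]
    · simp only [MonoidHom.comp_apply, MulEquiv.coe_toMonoidHom, swap_t, toRtimesGroup_t,
        MulAut.conj_apply]
      group
  rw [← mul_inv_eq_iff_eq_mul]
  exact DFunLike.congr_fun h g

theorem toRtimesGroup_injective_and_index :
    Function.Injective (toRtimesGroup A) ∧ (toRtimesGroup A).range.index = 2 := by
  obtain ⟨E, _, i, s, ε, hi, hss, hs, hεi, hεs⟩ :=
    -- The choice `c = t⁻¹` reflects that `t` goes to the inverse square of the stable letter, whose
    -- role in `E` is played by `s`.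
    exists_extension_of_sq_eq_conj (swap A) (t A A)⁻¹ swap_swap (by simp)
  let F : RtimesGroup A →* E :=
    HNNExtension.lift (MonoidHom.noncommCoprod (i.comp (ofLeft A A)) (i.comp (ofRight A A))
      fun a b => (commute_left_right a b).map i) s <| by
        rintro ⟨_, a, rfl⟩
        -- Once the edge isomorphism is evaluated at `(a, 1)`, the HNN relation becomes `s * i a = i
        -- (swap a) * s`.
        have e : leftFactorEquivRightFactor A ⟨MonoidHom.inl A A a, a, rfl⟩ =
            ⟨MonoidHom.inr A A a, a, rfl⟩ := by
          have : (⟨MonoidHom.inl A A a, a, rfl⟩ : (MonoidHom.inl A A).range) =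
              MonoidHom.ofInjective (f := MonoidHom.inl A A)
                (fun _ _ h => congrArg Prod.fst h) a := rfl
          rw [this, leftFactorEquivRightFactor, MulEquiv.trans_apply, MulEquiv.symm_apply_apply]
          rfl
        rw [e]
        simpa using hs (ofLeft A A a)
  have hF : F.comp (toRtimesGroup A) = i := by
    refine hom_ext (by simp [F]) (by simp [F]) ?_
    simp [F, pow_two, ← mul_inv_rev, hss]
  have hF' (g : SquareGroup A A) : F (toRtimesGroup A g) = i g := DFunLike.congr_fun hF g
  refine ⟨Function.Injective.of_comp (f := F) ?_, ?_⟩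
  · rwa [← MonoidHom.coe_comp, hF]
  · refine MonoidHom.index_range_eq_two _ HNNExtension.t (swap A) (t A A)⁻¹
      (by simp [pow_two]) (t_mul_toRtimesGroup A) ?_ (ε.comp F)
      (fun n => by simp [hF', hεi]) (by simpa [F] using hεs)
    have hr (g : SquareGroup A A) : toRtimesGroup A g ∈
        Subgroup.closure (Set.range (toRtimesGroup A) ∪ {HNNExtension.t}) :=
      Subgroup.subset_closure (Or.inl ⟨g, rfl⟩)
    rw [eq_top_iff]
    rintro x -
    induction x using HNNExtension.induction_on with
    | of g =>
      -- The whole base group lies in the image, as `(a, b) = (a, 1) (1, b)`.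
      have h := hr (ofLeft A A g.1 * ofRight A A g.2)
      rw [map_mul, toRtimesGroup_ofLeft, toRtimesGroup_ofRight, ← map_mul] at h
      simpa using h
    | t => exact Subgroup.subset_closure (Or.inr rfl)
    | mul x y hx hy => exact mul_mem hx hy
    | inv x hx => exact inv_mem hx

end SquareGroup

theorem mainTheorem8 :
    (∀ (A : Type u) (B : Type v) [Group A] [Group B],
      ∃ f : SquareGroup A B →* PathProduct A B,
        (∀ a : A, f (SquareGroup.ofLeft A B a) = PathProduct.ofLeft A B a) ∧
        (∀ b : B, f (SquareGroup.ofRight A B b) = PathProduct.ofRight A B b) ∧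
        f (SquareGroup.t A B) = PathProduct.x A B * PathProduct.y A B ∧
        Function.Injective f) ∧
    (∀ (A : Type u) [Group A],
      (∃ ι : SquareGroup A A →* RtimesGroup A,
        (∀ a : A, ι (SquareGroup.ofLeft A A a) = HNNExtension.of (a, 1)) ∧
        (∀ a : A, ι (SquareGroup.ofRight A A a) = HNNExtension.of (1, a)) ∧
        ι (SquareGroup.t A A) = HNNExtension.t⁻¹ ^ 2 ∧
        Function.Injective ι ∧ ι.range.index = 2) ∧
      (∃ f : SquareGroup A A →* PathProduct A A,
        (∀ a : A, f (SquareGroup.ofLeft A A a) = PathProduct.ofLeft A A a) ∧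
        (∀ a : A, f (SquareGroup.ofRight A A a) = PathProduct.ofRight A A a) ∧
        f (SquareGroup.t A A) = PathProduct.x A A * PathProduct.y A A ∧
        Function.Injective f ∧ IsVirtualRetract f.range)) := by
  refine ⟨fun A B _ _ => ⟨SquareGroup.toPathProduct A B, ?_, ?_, ?_,
    (SquareGroup.toPathProduct_injective_and_index A B).1⟩, fun A _ =>
    ⟨⟨SquareGroup.toRtimesGroup A, ?_, ?_, ?_,
      SquareGroup.toRtimesGroup_injective_and_index A⟩,
    ⟨SquareGroup.toPathProduct A A, ?_, ?_, ?_,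
      (SquareGroup.toPathProduct_injective_and_index A A).1,
      IsVirtualRetract.of_finiteIndex _ ⟨by
        rw [(SquareGroup.toPathProduct_injective_and_index A A).2]
        decide⟩⟩⟩⟩ <;>
  simp [SquareGroup.toPathProduct]
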